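/- Let $A$ be a boolean algebra. We use the following definitions. A poset $P$ has the **FN** (Freese–Nation property) if there is a map $f$ assigning to each $x\in P$ a finite set $f(x)\subseteq P$ such that for all $x\le y$ in $P$ there is $z\in f(x)\cap f(y)$ with $x\le z\le y$. Subsets $S,T$ of a poset **commute** if for all $x\in S$ and $y\in T$: if $x\le y$, then there is $z\in S\cap T$ with $x\le z\le y$, and if $y\le x$, then there is $z\in S\cap T$ with $y\le z\le x$. A boolean algebra has the **SFN** (strong Freese–Nation property) if it has a family $\mathcal C$ of finite boolean subalgebras such that every finite subset of the algebra is contained in a member of $\mathcal C$ (that is, $\mathcal C$ is cofinal) and any two members of $\mathcal C$ commute. A **partial algebra** is a pair $B=(U,\mathcal F)$ where $U$ is a set and $\mathcal F$ is a set of finitary partial operations on $U$, that is, partial functions from $U^n$ to $U$, where $n<\omega$ may depend on the function; $B$ is an **algebra** if all these operations are total. A **subalgebra** of $B$ is a subset $S\subseteq U$ (equipped with the restricted operations) such that $g(v)\in S$ whenever $g\in\mathcal F$ and $v\in\operatorname{dom}(g)$ is a tuple from $S$. $B$ is **locally finite** if every finite subset of $U$ is contained in a finite subalgebra of $B$. A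 subalgebra $S$ is **cyclic** if for some $x\in S$ it is the smallest subalgebra of $B$ containing $x$. $(U,\mathcal G)$ **expands** $(U,\mathcal F)$ if $\mathcal F\subseteq\mathcal G$; here $A$ itself is regarded as an algebra with operations $\wedge,\vee,-,0,1$. A partial algebra $B$ is **strongly $A$-commuting** if its universe is that of $A$, it is locally finite, and any two cyclic subalgebras of $B$ commute as subsets of the poset $(A,\le_A)$. **Theorem.** For every boolean algebra $A$: 1. $A$ has the FN if and only if there is a strongly $A$-commuting algebra. 2. $A$ has the SFN if and only if there is a strongly $A$-commuting algebra expanding $A$. 3. $A$ has the FN if and only if there is a strongly $A$-commuting partial algebra. 4. $A$ has the SFN if and only if there is a strongly $A$-commuting partial algebra expanding $A$. -/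

import Mathlib

/-- A map from a poset to its power set is interpolating if, whenever `x ≤ y`, some
`z ∈ [x, y]` belongs to `f x ∩ f y`. -/
def IsInterpolating {P : Type*} [PartialOrder P] (f : P → Set P) : Prop :=
  ∀ x y : P, x ≤ y → (Set.Icc x y ∩ f x ∩ f y).Nonempty

/-- The Freese-Nation property: there is an interpolating map with finite values. -/
def HasFN (P : Type*) [PartialOrder P] : Prop :=
  ∃ f : P → Set P, (∀ x, (f x).Finite) ∧ IsInterpolating f

/-- Two subsets `S` and `T` of a poset commute. -/
def SetsCommute {P : Type*} [PartialOrder P] (S T : Set P) : Prop :=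
  ∀ x ∈ S, ∀ y ∈ T,
    (x ≤ y → (Set.Icc x y ∩ S ∩ T).Nonempty) ∧ (y ≤ x → (Set.Icc y x ∩ S ∩ T).Nonempty)

/-- The strong Freese-Nation property: there is a pairwise commuting family of finite
boolean subalgebras that is cofinal, that is, every finite subset of the algebra is contained
in a member of the family. -/
def HasSFN (A : Type*) [BooleanAlgebra A] : Prop :=
  ∃ C : Set (BooleanSubalgebra A),
    (∀ F ∈ C, (F : Set A).Finite) ∧
    (∀ S : Set A, S.Finite → ∃ F ∈ C, S ⊆ (F : Set A)) ∧
    (∀ F ∈ C, ∀ G ∈ C, SetsCommute (F : Set A) (G : Set A))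

/-- A partial algebra with universe `U`: an arbitrary set of finitary partial operations on `U`
(arity `0` is allowed). -/
structure PartialAlgebra (U : Type*) where
  /-- The operations, each given with its arity. -/
  ops : Set (Σ n : ℕ, (Fin n → U) →. U)

namespace PartialAlgebra

variable {U : Type*}

/-- A partial algebra is an algebra if all its operations are total. -/
def IsAlgebra (B : PartialAlgebra U) : Prop :=
  ∀ g ∈ B.ops, g.2.Dom = Set.univ

/-- `S` is the universe of a subalgebra of `B`: it contains every defined value of an operation
at a tuple from `S`. The operations of the subalgebra are the restrictions to `S` of
those of `B`, so a subalgebra is determined by its universe, with which it is identified. -/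
def IsSubalgebra (B : PartialAlgebra U) (S : Set U) : Prop :=
  ∀ g ∈ B.ops, ∀ v : Fin g.1 → U, (∀ i, v i ∈ S) → ∀ y ∈ g.2 v, y ∈ S

/-- Every finite subset of the universe is contained in a finite subalgebra. -/
def IsLocallyFinite (B : PartialAlgebra U) : Prop :=
  ∀ S : Set U, S.Finite → ∃ T : Set U, T.Finite ∧ S ⊆ T ∧ B.IsSubalgebra T

/-- `S` is a cyclic subalgebra of `B`: for some `x ∈ S`, it is the smallest subalgebra
containing `x`. -/
def IsCyclicSubalgebra (B : PartialAlgebra U) (S : Set U) : Prop :=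
  ∃ x ∈ S, IsLeast {T : Set U | B.IsSubalgebra T ∧ x ∈ T} S

/-- `B` expands `B'` (on the same universe): every operation of `B'` is an operation of `B`. -/
def Expands (B B' : PartialAlgebra U) : Prop :=
  B'.ops ⊆ B.ops

/-- A boolean algebra as an algebra, with operations meet, join, complement, `0` and `1`. -/
def ofBooleanAlgebra (A : Type*) [BooleanAlgebra A] : PartialAlgebra A where
  ops :=
    { ⟨2, PFun.lift fun v => v 0 ⊓ v 1⟩,
      ⟨2, PFun.lift fun v => v 0 ⊔ v 1⟩,
      ⟨1, PFun.lift fun v => (v 0)ᶜ⟩,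
      ⟨0, PFun.lift fun _ => ⊥⟩,
      ⟨0, PFun.lift fun _ => ⊤⟩ }

/-- A partial algebra `B` on the universe of the boolean algebra `A` is strongly
`A`-commuting. -/
def IsStronglyCommuting {A : Type*} [BooleanAlgebra A] (B : PartialAlgebra A) : Prop :=
  B.IsLocallyFinite ∧
    ∀ F G : Set A, B.IsCyclicSubalgebra F → B.IsCyclicSubalgebra G → SetsCommute F G

end PartialAlgebra

/-! In a strongly commuting partial algebra, `x ↦ B.cyclic x` is a Freese-Nation map. Each
subalgebra contains the cyclic subalgebras of its points, so any two subalgebras commute; if `B`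
expands `A`, the finite ones witness the SFN. Conversely, a closure operator that is finite on
finite sets and has commuting values at singletons suffices: `ofClosure` turns it into an algebra.
For the SFN it is intersection of members of the family (`SetsCommute.sInter`). For the FN,
iterating the given map may destroy finiteness, so `HasFN.exists_transitive` replaces it: points are
layered into countable pieces that the map never leaves upwards, and each piece is enumerated. -/

section FreeseNation

/-! ### Transitive Freese-Nation maps -/

variable {P : Type*} [PartialOrder P]

/-- For a finite-valued map `f`, every point gets a rank that `f` does not increase, and a number
that is unique among the points of the same rank. -/
theorem exists_rank_of_finite.{u} {P : Type u} (f : P → Set P) (hf : ∀ x, (f x).Finite) :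
    ∃ (ρ : P → Cardinal.{u}) (n : P → ℕ), (∀ x, ∀ y ∈ f x, ρ y ≤ ρ x) ∧
      ∀ x y, ρ x = ρ y → n x = n y → x = y := by
  -- `K a` is the closure of `a` under `f`, a countable set.
  let K : P → Set P := fun a => ⋃ k : ℕ, (fun s => ⋃ x ∈ s, f x)^[k] {a}
  have hK : ∀ a, (K a).Countable := fun a => by
    refine Set.countable_iUnion fun k => Set.Finite.countable ?_
    induction k with
    | zero => simp
    | succ k ih =>
      rw [Function.iterate_succ_apply']
      exact ih.biUnion fun x _ => hf x
  have hKf : ∀ a, ∀ x ∈ K a, ∀ y ∈ f x, y ∈ K a := fun a x hx y hy => by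
    obtain ⟨k, hk⟩ := Set.mem_iUnion.1 hx
    refine Set.mem_iUnion.2 ⟨k + 1, ?_⟩
    rw [Function.iterate_succ_apply']
    exact Set.mem_biUnion hk hy
  have hKx : ∀ x, {a | x ∈ K a}.Nonempty := fun x => ⟨x, Set.mem_iUnion.2 ⟨0, rfl⟩⟩
  -- The embedding only serves to well-order `P`; `α x` is the first `a` with `x ∈ K a`. Points of
  -- equal rank share one countable `K a`, whose enumeration separates them.
  let e : P ↪ Cardinal.{u} := embeddingToCardinal
  let α : P → P := fun x => Function.argminOn e {a | x ∈ K a} (hKx x)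
  have hα : ∀ x, x ∈ K (α x) := fun x => Function.argminOn_mem e {a | x ∈ K a} (hKx x)
  choose i hi using fun a => Set.countable_iff_exists_injOn.1 (hK a)
  refine ⟨fun x => e (α x), fun x => i (α x) x, fun x y hy => ?_, fun x y hxy hn => ?_⟩
  · exact Function.argminOn_le e {a | y ∈ K a} (hKf _ x (hα x) y hy)
  · have h : α x = α y := e.injective hxy
    refine hi (α y) (h ▸ hα x) (hα y) ?_
    simpa only [h] using hn

/-- The Freese-Nation property is witnessed by the initial segments of a preorder all of whose
principal initial segments are finite. -/
theorem HasFN.exists_transitive (h : HasFN P) :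
    ∃ E : P → P → Prop, (∀ x, {y | Relation.ReflTransGen E y x}.Finite) ∧
      IsInterpolating fun x => {y | Relation.ReflTransGen E y x} := by
  obtain ⟨f, hf, hint⟩ := h
  obtain ⟨ρ, n, hρ, hn⟩ := exists_rank_of_finite f hf
  let E : P → P → Prop := fun y x => (ρ y = ρ x ∧ n y < n x) ∨ (y ∈ f x ∧ ρ y < ρ x)
  have hwf : WellFounded E := by
    refine Subrelation.wf (r := InvImage (Prod.Lex (· < ·) (· < ·)) fun x => (ρ x, n x)) ?_
      (InvImage.wf _ (WellFounded.prod_lex wellFounded_lt wellFounded_lt))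
    rintro y x (⟨h1, h2⟩ | ⟨-, h2⟩)
    · exact Prod.lex_def.2 (Or.inr ⟨h1, h2⟩)
    · exact Prod.lex_def.2 (Or.inl h2)
  have hEfin : ∀ x, {y | E y x}.Finite := fun x => by
    refine (Set.Finite.union (s := {y | ρ y = ρ x ∧ n y < n x}) ?_ (hf x)).subset ?_
    · refine Set.Finite.of_finite_image (f := n) ((Set.finite_lt_nat (n x)).subset ?_) ?_
      · rintro _ ⟨y, hy, rfl⟩
        exact hy.2
      · exact fun y hy z hz hyz => hn y z (hy.1.trans hz.1.symm) hyz
    · rintro y (hy | hy)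
      · exact Or.inl hy
      · exact Or.inr hy.1
  refine ⟨E, fun x => ?_, ?_⟩
  -- `E` is well-founded with finitely many immediate predecessors at each point, so its initial
  -- segments are finite.
  · induction x using hwf.induction with
    | _ x ih =>
      refine ((Set.finite_singleton x).union ((hEfin x).biUnion ih)).subset fun y hy => ?_
      rcases Relation.ReflTransGen.cases_tail hy with hxy | ⟨z, hyz, hzx⟩
      · exact Or.inl hxy.symm
      · exact Or.inr (Set.mem_biUnion (show z ∈ {y | E y x} from hzx) hyz)
  -- Induction on a common bound of the ranks. If the ranks differ, the interpolant `z` given by `f`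
  -- has at most the smaller rank, so it is an `E`-predecessor of the endpoint of larger rank; the
  -- induction hypothesis applies to `z` and the other endpoint.
  · suffices H : ∀ o, ∀ x y, ρ x ≤ o → ρ y ≤ o → x ≤ y → (Set.Icc x y ∩
        {z | Relation.ReflTransGen E z x} ∩ {z | Relation.ReflTransGen E z y}).Nonempty from
      fun x y hxy => H _ x y (le_max_left (ρ x) (ρ y)) (le_max_right _ _) hxy
    intro o
    induction o using WellFoundedLT.induction with
    | _ o ih =>
      intro x y hxo hyo hxy
      obtain ⟨z, ⟨⟨hxz, hzy⟩, hzx⟩, hzy'⟩ := hint x y hxy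
      rcases lt_trichotomy (ρ x) (ρ y) with hlt | heq | hlt
      · have hz := hρ x z hzx
        obtain ⟨w, ⟨hw, hwx⟩, hwz⟩ := ih (ρ x) (hlt.trans_le hyo) x z le_rfl hz hxz
        exact ⟨w, ⟨⟨hw.1, hw.2.trans hzy⟩, hwx⟩,
          Relation.ReflTransGen.tail hwz (Or.inr ⟨hzy', hz.trans_lt hlt⟩)⟩
      -- Points of equal rank are `E`-comparable or equal, so an endpoint itself interpolates.
      · rcases lt_trichotomy (n x) (n y) with hl | he | hl
        · exact ⟨x, ⟨⟨le_rfl, hxy⟩, .refl⟩, .single (Or.inl ⟨heq, hl⟩)⟩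
        · obtain rfl := hn x y heq he
          exact ⟨x, ⟨⟨le_rfl, le_rfl⟩, .refl⟩, .refl⟩
        · exact ⟨y, ⟨⟨hxy, le_rfl⟩, .single (Or.inl ⟨heq.symm, hl⟩)⟩, .refl⟩
      · have hz := hρ y z hzy'
        obtain ⟨w, ⟨hw, hwz⟩, hwy⟩ := ih (ρ y) (hlt.trans_le hxo) z y hz le_rfl hzy
        exact ⟨w, ⟨⟨hxz.trans hw.1, hw.2⟩,
          Relation.ReflTransGen.tail hwz (Or.inr ⟨hzx, hz.trans_lt hlt⟩)⟩, hwy⟩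

/-! ### Commuting sets and their intersections -/

theorem SetsCommute.symm {S T : Set P} (h : SetsCommute S T) : SetsCommute T S := by
  intro x hx y hy
  have := h y hy x hx
  rw [Set.inter_right_comm _ T S, Set.inter_right_comm _ T S]
  exact this.symm

theorem SetsCommute.toDual {S T : Set P} (h : SetsCommute S T) :
    SetsCommute (P := Pᵒᵈ) S T := by
  intro x hx y hy
  obtain ⟨h1, h2⟩ := h x hx y hy
  refine ⟨fun hxy => ?_, fun hxy => ?_⟩
  · obtain ⟨z, ⟨hz, hS⟩, hT⟩ := h2 hxy
    exact ⟨z, ⟨⟨hz.2, hz.1⟩, hS⟩, hT⟩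
  · obtain ⟨z, ⟨hz, hS⟩, hT⟩ := h1 hxy
    exact ⟨z, ⟨⟨hz.2, hz.1⟩, hS⟩, hT⟩

/-- If each `S ∈ 𝒮` commutes with the finite set `T`, then a minimal element of `T` in an interval
with bottom in `⋂₀ 𝒮` belongs to every `S ∈ 𝒮`. -/
theorem SetsCommute.nonempty_Icc_sInter {𝒮 : Set (Set P)} {T : Set P} (hT : T.Finite)
    (h : ∀ S ∈ 𝒮, SetsCommute S T) {x y : P} (hx : x ∈ ⋂₀ 𝒮) (hy : y ∈ T) (hxy : x ≤ y) :
    (Set.Icc x y ∩ ⋂₀ 𝒮 ∩ T).Nonempty := by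
  obtain ⟨m, hm⟩ := (hT.subset (Set.inter_subset_left (t := Set.Icc x y))).exists_minimal
    ⟨y, hy, hxy, le_rfl⟩
  refine ⟨m, ⟨hm.prop.2, fun S hS => ?_⟩, hm.prop.1⟩
  obtain ⟨z, ⟨⟨hxz, hzm⟩, hzS⟩, hzT⟩ := (h S hS x (hx S hS) m hm.prop.1).1 hm.prop.2.1
  have : m ≤ z := hm.le_of_le ⟨hzT, hxz, hzm.trans hm.prop.2.2⟩ hzm
  exact le_antisymm this hzm ▸ hzS

theorem SetsCommute.sInter_left {𝒮 : Set (Set P)} {T : Set P} (hT : T.Finite)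
    (h : ∀ S ∈ 𝒮, SetsCommute S T) : SetsCommute (⋂₀ 𝒮) T := by
  refine fun x hx y hy => ⟨nonempty_Icc_sInter hT h hx hy, fun hyx => ?_⟩
  obtain ⟨z, ⟨hz, hS⟩, hT⟩ :=
    nonempty_Icc_sInter (P := Pᵒᵈ) hT (fun S hS => (h S hS).toDual) hx hy hyx
  exact ⟨z, ⟨⟨hz.2, hz.1⟩, hS⟩, hT⟩

/-- Each finite `T ∈ 𝒯` commutes with `⋂₀ 𝒮`; as `⋂₀ 𝒮` is finite, the roles can be exchanged to
intersect over `𝒯`. -/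
theorem SetsCommute.sInter {𝒮 𝒯 : Set (Set P)} (h𝒮 : (⋂₀ 𝒮).Finite)
    (h𝒯 : ∀ T ∈ 𝒯, T.Finite) (h : ∀ S ∈ 𝒮, ∀ T ∈ 𝒯, SetsCommute S T) :
    SetsCommute (⋂₀ 𝒮) (⋂₀ 𝒯) :=
  (sInter_left h𝒮 fun T hT => (sInter_left (h𝒯 T hT) fun S hS => h S hS T hT).symm).symm

/-- An interpolating map whose values are closed under it has pairwise commuting values. -/
theorem IsInterpolating.setsCommute {f : P → Set P} (h : IsInterpolating f)
    (hf : ∀ x, ∀ y ∈ f x, f y ⊆ f x) (a b : P) : SetsCommute (f a) (f b) := by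
  refine fun x hx y hy => ⟨fun hxy => ?_, fun hyx => ?_⟩
  · obtain ⟨z, ⟨hz, hzx⟩, hzy⟩ := h x y hxy
    exact ⟨z, ⟨hz, hf a x hx hzx⟩, hf b y hy hzy⟩
  · obtain ⟨z, ⟨hz, hzy⟩, hzx⟩ := h y x hyx
    exact ⟨z, ⟨hz, hf a x hx hzx⟩, hf b y hy hzy⟩

end FreeseNation

/-! ### Partial algebras and closure operators -/

namespace PartialAlgebra

variable {U : Type*}

theorem IsSubalgebra.sInter {B : PartialAlgebra U} {𝒮 : Set (Set U)}
    (h : ∀ S ∈ 𝒮, B.IsSubalgebra S) : B.IsSubalgebra (⋂₀ 𝒮) :=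
  fun g hg v hv y hy S hS => h S hS g hg v (fun i => hv i S hS) y hy

/-- The subalgebra generated by a point. -/
def cyclic (B : PartialAlgebra U) (x : U) : Set U :=
  ⋂₀ {T | B.IsSubalgebra T ∧ x ∈ T}

theorem mem_cyclic (B : PartialAlgebra U) (x : U) : x ∈ B.cyclic x :=
  fun _ hT => hT.2

theorem cyclic_subset {B : PartialAlgebra U} {T : Set U} (hT : B.IsSubalgebra T) {x : U}
    (hx : x ∈ T) : B.cyclic x ⊆ T :=
  Set.sInter_subset_of_mem ⟨hT, hx⟩

theorem isCyclicSubalgebra_cyclic (B : PartialAlgebra U) (x : U) :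
    B.IsCyclicSubalgebra (B.cyclic x) :=
  ⟨x, B.mem_cyclic x, ⟨IsSubalgebra.sInter fun _ hT => hT.1, B.mem_cyclic x⟩,
    fun _ hT => cyclic_subset hT.1 hT.2⟩

theorem IsLocallyFinite.finite_cyclic {B : PartialAlgebra U} (h : B.IsLocallyFinite) (x : U) :
    (B.cyclic x).Finite := by
  obtain ⟨T, hT, hxT, hBT⟩ := h {x} (Set.finite_singleton x)
  exact hT.subset (cyclic_subset hBT (hxT rfl))

/-- The algebra of all total operations whose value always lies in the closure of the set of
arguments. -/
def ofClosure (c : ClosureOperator (Set U)) : PartialAlgebra U where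
  ops := {g | ∃ h : (Fin g.1 → U) → U, g.2 = PFun.lift h ∧ ∀ v, h v ∈ c (Set.range v)}

theorem isAlgebra_ofClosure (c : ClosureOperator (Set U)) : (ofClosure c).IsAlgebra := by
  rintro g ⟨h, hg, -⟩
  rw [hg]
  rfl

theorem isSubalgebra_ofClosure (c : ClosureOperator (Set U)) (S : Set U) :
    (ofClosure c).IsSubalgebra (c S) := by
  rintro g ⟨h, hg, hc⟩ v hv y hy
  rw [hg] at hy
  obtain rfl : y = h v := by simpa using hy
  exact c.le_closure_iff.1 (Set.range_subset_iff.2 hv) (hc v)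

theorem closure_singleton_subset {c : ClosureOperator (Set U)} {T : Set U}
    (hT : (ofClosure c).IsSubalgebra T) {x : U} (hx : x ∈ T) : c {x} ⊆ T := by
  classical
  intro y hy
  -- Sends `x` to `y` and fixes all other points, hence never leaves the closure of its argument.
  let h : (Fin 1 → U) → U := fun v => if v 0 = x then y else v 0
  refine hT ⟨1, PFun.lift h⟩ ⟨h, rfl, fun v => ?_⟩ (fun _ => x) (fun _ => hx) y ?_
  · by_cases hv : v 0 = x
    · simp only [h, hv, if_true]
      refine c.monotone ?_ hy
      rintro _ rfl
      exact ⟨0, hv⟩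
    · simp only [h, hv, if_false]
      exact c.le_closure _ ⟨0, rfl⟩
  · simp [h]

theorem isStronglyCommuting_ofClosure {A : Type*} [BooleanAlgebra A]
    (c : ClosureOperator (Set A)) (hfin : ∀ S : Set A, S.Finite → (c S).Finite)
    (hcomm : ∀ x y, SetsCommute (c {x}) (c {y})) : (ofClosure c).IsStronglyCommuting := by
  refine ⟨fun S hS => ⟨c S, hfin S hS, c.le_closure S, isSubalgebra_ofClosure c S⟩, ?_⟩
  -- The cyclic subalgebras are the closures of points.
  have key : ∀ F, (ofClosure c).IsCyclicSubalgebra F → ∃ x, F = c {x} := by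
    rintro F ⟨x, hxF, ⟨hF, -⟩, hmin⟩
    exact ⟨x, (hmin ⟨isSubalgebra_ofClosure c {x}, c.le_closure {x} rfl⟩).antisymm
      (closure_singleton_subset hF hxF)⟩
  intro F G hF hG
  obtain ⟨x, rfl⟩ := key F hF
  obtain ⟨y, rfl⟩ := key G hG
  exact hcomm x y

theorem IsStronglyCommuting.hasFN {A : Type*} [BooleanAlgebra A] {B : PartialAlgebra A}
    (h : B.IsStronglyCommuting) : HasFN A :=
  ⟨B.cyclic, h.1.finite_cyclic, fun x y hxy =>
    (h.2 _ _ (B.isCyclicSubalgebra_cyclic x) (B.isCyclicSubalgebra_cyclic y)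
      x (B.mem_cyclic x) y (B.mem_cyclic y)).1 hxy⟩

/-- Any two subalgebras of a strongly commuting partial algebra commute. -/
theorem IsStronglyCommuting.setsCommute {A : Type*} [BooleanAlgebra A] {B : PartialAlgebra A}
    (h : B.IsStronglyCommuting) {S T : Set A} (hS : B.IsSubalgebra S) (hT : B.IsSubalgebra T) :
    SetsCommute S T := fun x hx y hy => by
  have hsub : ∀ I : Set A, I ∩ B.cyclic x ∩ B.cyclic y ⊆ I ∩ S ∩ T := fun I =>
    Set.inter_subset_inter (Set.inter_subset_inter_right _ (cyclic_subset hS hx))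
      (cyclic_subset hT hy)
  have := h.2 _ _ (B.isCyclicSubalgebra_cyclic x) (B.isCyclicSubalgebra_cyclic y)
      x (B.mem_cyclic x) y (B.mem_cyclic y)
  exact ⟨fun hxy => (this.1 hxy).mono (hsub _), fun hyx => (this.2 hyx).mono (hsub _)⟩

theorem IsSubalgebra.exists_booleanSubalgebra {A : Type*} [BooleanAlgebra A]
    {B : PartialAlgebra A} (hB : B.Expands (ofBooleanAlgebra A)) {S : Set A}
    (hS : B.IsSubalgebra S) : ∃ F : BooleanSubalgebra A, (F : Set A) = S := by
  have hinf : ∀ x ∈ S, ∀ y ∈ S, x ⊓ y ∈ S := fun x hx y hy =>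
    hS ⟨2, PFun.lift fun v => v 0 ⊓ v 1⟩ (hB (by simp [ofBooleanAlgebra])) ![x, y]
      (by simp [Fin.forall_fin_two, hx, hy]) _ (by simp)
  have hsup : ∀ x ∈ S, ∀ y ∈ S, x ⊔ y ∈ S := fun x hx y hy =>
    hS ⟨2, PFun.lift fun v => v 0 ⊔ v 1⟩ (hB (by simp [ofBooleanAlgebra])) ![x, y]
      (by simp [Fin.forall_fin_two, hx, hy]) _ (by simp)
  have hcompl : ∀ x ∈ S, xᶜ ∈ S := fun x hx =>
    hS ⟨1, PFun.lift fun v => (v 0)ᶜ⟩ (hB (by simp [ofBooleanAlgebra])) ![x]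
      (by simp [hx]) _ (by simp)
  have hbot : ⊥ ∈ S :=
    hS ⟨0, PFun.lift fun _ => ⊥⟩ (hB (by simp [ofBooleanAlgebra])) ![] (by simp) _ (by simp)
  exact ⟨{ carrier := S
           supClosed' := fun x hx y hy => hsup x hx y hy
           infClosed' := fun x hx y hy => hinf x hx y hy
           compl_mem' := fun {x} hx => hcompl x hx
           bot_mem' := hbot }, rfl⟩

theorem IsStronglyCommuting.hasSFN {A : Type*} [BooleanAlgebra A] {B : PartialAlgebra A}
    (h : B.IsStronglyCommuting) (hB : B.Expands (ofBooleanAlgebra A)) : HasSFN A := by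
  refine ⟨{F | (F : Set A).Finite ∧ B.IsSubalgebra (F : Set A)}, fun F hF => hF.1,
    fun S hS => ?_, fun F hF G hG => h.setsCommute hF.2 hG.2⟩
  obtain ⟨T, hT, hST, hBT⟩ := h.1 S hS
  obtain ⟨F, rfl⟩ := hBT.exists_booleanSubalgebra hB
  exact ⟨F, ⟨hT, hBT⟩, hST⟩

/-- The boolean operations stay in the closure of their arguments; for the constants this is the
closure of `∅`. -/
theorem expands_ofClosure {A : Type*} [BooleanAlgebra A] {c : ClosureOperator (Set A)}
    (hc : ∀ S, ∃ F : BooleanSubalgebra A, (F : Set A) = c S) :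
    (ofClosure c).Expands (ofBooleanAlgebra A) := by
  have key : ∀ {n : ℕ} (v : Fin n → A),
      ∃ F : BooleanSubalgebra A, (F : Set A) = c (Set.range v) ∧ ∀ i, v i ∈ F := fun v => by
    obtain ⟨F, hF⟩ := hc (Set.range v)
    exact ⟨F, hF, fun i => SetLike.mem_coe.1 (hF ▸ c.le_closure _ ⟨i, rfl⟩)⟩
  rintro g (rfl | rfl | rfl | rfl | rfl) <;>
    refine ⟨_, rfl, fun v => ?_⟩ <;>
    obtain ⟨F, hF, hv⟩ := key v <;>
    rw [← hF, SetLike.mem_coe]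
  · exact BooleanSubalgebra.inf_mem (hv 0) (hv 1)
  · exact BooleanSubalgebra.sup_mem (hv 0) (hv 1)
  · exact BooleanSubalgebra.compl_mem (hv 0)
  · exact BooleanSubalgebra.bot_mem
  · exact BooleanSubalgebra.top_mem

end PartialAlgebra

/-! ### The two closure operators and the equivalences -/

open PartialAlgebra

/-- Closing a set under a relation downwards. -/
def reflTransGenClosure {P : Type*} (E : P → P → Prop) : ClosureOperator (Set P) :=
  .mk' (fun S => {y | ∃ x ∈ S, Relation.ReflTransGen E y x})
    (fun _ _ hST _ ⟨x, hx, hyx⟩ => ⟨x, hST hx, hyx⟩) (fun _ x hx => ⟨x, hx, .refl⟩)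
    (fun _ _ ⟨_, ⟨x, hx, hyx⟩, hzy⟩ => ⟨x, hx, hzy.trans hyx⟩)

/-- The intersection of the members of a family that contain a set. -/
def sInterClosure {P : Type*} (C : Set (Set P)) : ClosureOperator (Set P) :=
  .mk' (fun S => ⋂₀ {F | F ∈ C ∧ S ⊆ F})
    (fun _ _ hST _ hx F hF => hx F ⟨hF.1, hST.trans hF.2⟩) (fun _ _ hx _ hF => hF.2 hx)
    (fun _ _ hx F hF => hx F ⟨hF.1, Set.sInter_subset_of_mem hF⟩)

theorem HasFN.exists_isStronglyCommuting {A : Type*} [BooleanAlgebra A] (h : HasFN A) :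
    ∃ B : PartialAlgebra A, B.IsAlgebra ∧ B.IsStronglyCommuting := by
  obtain ⟨E, hfin, hint⟩ := h.exists_transitive
  have hc : ∀ x, reflTransGenClosure E {x} = {y | Relation.ReflTransGen E y x} := fun x => by
    ext y
    change (∃ z ∈ ({x} : Set A), Relation.ReflTransGen E y z) ↔ Relation.ReflTransGen E y x
    simp
  refine ⟨ofClosure (reflTransGenClosure E), isAlgebra_ofClosure _,
    isStronglyCommuting_ofClosure _ (fun S hS => ?_) fun x y => ?_⟩
  · refine (hS.biUnion fun x _ => hfin x).subset ?_
    rintro y ⟨x, hx, hyx⟩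
    exact Set.mem_biUnion hx hyx
  · rw [hc, hc]
    exact hint.setsCommute (fun _ _ hyx _ hzy => hzy.trans hyx) x y

theorem HasSFN.exists_isStronglyCommuting {A : Type*} [BooleanAlgebra A] (h : HasSFN A) :
    ∃ B : PartialAlgebra A, B.IsAlgebra ∧ B.IsStronglyCommuting ∧
      B.Expands (ofBooleanAlgebra A) := by
  obtain ⟨C, hfin, hcof, hcomm⟩ := h
  let c := sInterClosure ((fun F : BooleanSubalgebra A => (F : Set A)) '' C)
  have hcfin : ∀ S : Set A, S.Finite → (c S).Finite := fun S hS => by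
    obtain ⟨F, hF, hSF⟩ := hcof S hS
    exact (hfin F hF).subset (Set.sInter_subset_of_mem ⟨⟨F, hF, rfl⟩, hSF⟩)
  refine ⟨ofClosure c, isAlgebra_ofClosure c,
    isStronglyCommuting_ofClosure c hcfin fun x y => ?_, expands_ofClosure fun S => ?_⟩
  · refine SetsCommute.sInter (hcfin {x} (Set.finite_singleton x)) ?_ ?_
    · rintro _ ⟨⟨F, hF, rfl⟩, -⟩
      exact hfin F hF
    · rintro _ ⟨⟨F, hF, rfl⟩, -⟩ _ ⟨⟨G, hG, rfl⟩, -⟩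
      exact hcomm F hF G hG
  · refine ⟨sInf {F | F ∈ C ∧ S ⊆ (F : Set A)}, ?_⟩
    ext x
    simp [c, sInterClosure]

theorem theorem3p11 (A : Type*) [BooleanAlgebra A] :
    (HasFN A ↔ ∃ B : PartialAlgebra A, B.IsAlgebra ∧ B.IsStronglyCommuting) ∧
    (HasSFN A ↔ ∃ B : PartialAlgebra A, B.IsAlgebra ∧ B.IsStronglyCommuting ∧
      B.Expands (PartialAlgebra.ofBooleanAlgebra A)) ∧
    (HasFN A ↔ ∃ B : PartialAlgebra A, B.IsStronglyCommuting) ∧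
    (HasSFN A ↔ ∃ B : PartialAlgebra A, B.IsStronglyCommuting ∧
      B.Expands (PartialAlgebra.ofBooleanAlgebra A)) := by
  refine ⟨⟨HasFN.exists_isStronglyCommuting, fun ⟨_, _, h⟩ => h.hasFN⟩,
    ⟨HasSFN.exists_isStronglyCommuting, fun ⟨_, _, h, hB⟩ => h.hasSFN hB⟩,
    ⟨fun h => ?_, fun ⟨_, h⟩ => h.hasFN⟩, ⟨fun h => ?_, fun ⟨_, h, hB⟩ => h.hasSFN hB⟩⟩
  · obtain ⟨B, -, hB⟩ := h.exists_isStronglyCommuting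
    exact ⟨B, hB⟩
  · obtain ⟨B, -, hB⟩ := h.exists_isStronglyCommuting
    exact ⟨B, hB⟩
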